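/- Let $G$ be a finite group. A right action of $G$ on a category $\mathscr D$ consists of auto-equivalences $\rho_g$ $(g\in G)$ and natural isomorphisms $\theta_{g,h}\colon\rho_g\rho_h\to\rho_{hg}$ with $\theta_{g,kh}\circ\rho_g\theta_{h,k}=\theta_{hg,k}\circ\theta_{g,h}\rho_k$ for all $g,h,k$. The equivariant category $\mathscr D^G$ has as objects the pairs $(X,\chi)$, where $\chi_g\colon X\to\rho_gX$ are isomorphisms with $\theta_{g,h}\circ\rho_g(\chi_h)\circ\chi_g=\chi_{hg}$, and as morphisms the morphisms of $\mathscr D$ that commute with the $\chi_g$; it is abelian if $\mathscr D$ is. A $G$-functor is a functor $F$ between categories with $G$-action together with natural isomorphisms $\sigma_g\colon F\rho_g\to\hat\rho_gF$ with $\sigma_{hg}\circ F\theta_{g,h}=\hat\theta_{g,h}F\circ\hat\rho_g\sigma_h\circ\sigma_g\rho_h$; it induces $F^G\colon(X,\chi)\mapsto(FX,(\sigma_g\circ F\chi_g)_g)$ on equivariant categories. For $k\ge 0$, an exact functor $F\colon\mathscr A\to\mathscr B$ of abelian categories is a $k$-homological embedding if the induced maps $\mathrm{Ext}^n_{\mathscr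 A}(X,Y)\to\mathrm{Ext}^n_{\mathscr B}(FX,FY)$ are bijective for all $X,Y\in\mathscr A$ and $0\le n\le k$. (1) Let $F\colon\mathscr A\to\mathscr B$ be an exact functor between abelian categories with $G$-actions which is a $G$-functor. If $F$ is a $k$-homological embedding, then $F^G\colon\mathscr A^G\to\mathscr B^G$ is a $k$-homological embedding. (2) Let $(\mathscr A,\mathscr B,\mathscr C)$ be a recollement of abelian categories, that is, functors $\mathsf i\colon\mathscr A\to\mathscr B$, $\mathsf q,\mathsf p\colon\mathscr B\to\mathscr A$, $\mathsf e\colon\mathscr B\to\mathscr C$, $\mathsf l,\mathsf r\colon\mathscr C\to\mathscr B$ with adjunctions $\mathsf q\dashv\mathsf i\dashv\mathsf p$ and $\mathsf l\dashv\mathsf e\dashv\mathsf r$, with $\mathsf i,\mathsf l,\mathsf r$ fully faithful, and with the essential image of $\mathsf i$ equal to $\operatorname{Ker}\mathsf e$. Assume that $\mathscr B$ has enough projectives or enough injectives, that $G$ acts on $\mathscr B$ with $|G|$ invertible in $\mathscr B$ (every morphism $f$ is of the form $|G|\cdot f'$), and that the recollement lifts to a $G$-equivariant recollement: either $G$ acts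 on $\mathscr C$ such that $\mathsf e$ is a $G$-functor, or the essential image of $\mathsf i$ is stable under all $\rho_g$. Then there is an induced $G$-action on $\mathscr A$ for which $\mathsf i$ is a $G$-functor, and for every such action and $G$-functor structure, and every $k\ge 0$, the functor $\mathsf i$ is a $k$-homological embedding if and only if $\mathsf i^G\colon\mathscr A^G\to\mathscr B^G$ is a $k$-homological embedding. -/

import Mathlib

open CategoryTheory CategoryTheory.Limits

universe w v u v₁ u₁ v₂ u₂ v₃ u₃

namespace Equivariant

/-- A right action `(ρ, θ)` of a group `G` on a category `D`: autoequivalences `ρ g` and natural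
isomorphisms `θ g h : ρ_g ∘ ρ_h ≅ ρ_{hg}` satisfying the 2-cocycle condition. (Functor composition
`⋙` is written in diagrammatic order; `eqToHom` identifies `ρ_{(kh)g}` with `ρ_{k(hg)}`.) -/
structure RightAction (G : Type w) [Group G] (D : Type u) [Category.{v} D] where
  ρ : G → D ⥤ D
  isEquivalence : ∀ g, (ρ g).IsEquivalence
  θ : ∀ g h, ρ h ⋙ ρ g ≅ ρ (h * g)
  cocycle : ∀ (g h k : G) (X : D),
    (ρ g).map ((θ h k).hom.app X) ≫ (θ g (k * h)).hom.app X ≫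
        eqToHom (by rw [mul_assoc]) =
      (θ g h).hom.app ((ρ k).obj X) ≫ (θ (h * g) k).hom.app X

attribute [instance] RightAction.isEquivalence

/-- An equivariant object `(X, χ)`: an object with a linearization. -/
structure EquivariantObject {G : Type w} [Group G] {D : Type u} [Category.{v} D]
    (α : RightAction G D) where
  obj : D
  χ : ∀ g, obj ≅ (α.ρ g).obj obj
  cocycle : ∀ g h : G,
    (χ g).hom ≫ (α.ρ g).map (χ h).hom ≫ (α.θ g h).hom.app obj = (χ (h * g)).hom

namespace EquivariantObject

section

variable {G : Type w} [Group G] {D : Type u} [Category.{v} D] {α : RightAction G D}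

/-- Morphisms of equivariant objects: morphisms commuting with the linearizations. -/
@[ext]
structure Hom (X Y : EquivariantObject α) where
  hom : X.obj ⟶ Y.obj
  comm : ∀ g : G, (X.χ g).hom ≫ (α.ρ g).map hom = hom ≫ (Y.χ g).hom

/-- The equivariant category `D^G`. -/
instance : Category (EquivariantObject α) where
  Hom X Y := Hom X Y
  id X := ⟨𝟙 X.obj, fun g => by simp⟩
  comp f f' := ⟨f.hom ≫ f'.hom, fun g => by
    rw [Functor.map_comp, ← Category.assoc, f.comm, Category.assoc, f'.comm, Category.assoc]⟩
  id_comp f := Hom.ext (Category.id_comp f.hom)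
  comp_id f := Hom.ext (Category.comp_id f.hom)
  assoc f f' f'' := Hom.ext (Category.assoc f.hom f'.hom f''.hom)

@[ext]
theorem hom_ext {X Y : EquivariantObject α} {f f' : X ⟶ Y} (h : f.hom = f'.hom) : f = f' :=
  Hom.ext h

@[simp]
theorem id_hom (X : EquivariantObject α) : Hom.hom (𝟙 X) = 𝟙 X.obj := rfl

@[simp]
theorem comp_hom {X Y Z : EquivariantObject α} (f : X ⟶ Y) (f' : Y ⟶ Z) :
    (f ≫ f').hom = f.hom ≫ f'.hom := rfl

variable (α) in
/-- The forgetful functor `D^G ⥤ D`. -/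
@[simps]
def forget : EquivariantObject α ⥤ D where
  obj X := X.obj
  map f := f.hom

instance : (forget α).Faithful where
  map_injective h := hom_ext h

instance : (forget α).ReflectsIsomorphisms where
  reflects {X Y} f hf := by
    have hf' : IsIso f.hom := hf
    refine ⟨⟨⟨inv f.hom, fun g => ?_⟩, ?_, ?_⟩⟩
    · rw [Functor.map_inv, IsIso.comp_inv_eq, Category.assoc, IsIso.eq_inv_comp, f.comm]
    · exact hom_ext (IsIso.hom_inv_id f.hom)
    · exact hom_ext (IsIso.inv_hom_id f.hom)

end

section Limits

variable {G : Type w} [Group G] {D : Type u} [Category.{v} D] {α : RightAction G D}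

theorem cocycle_of_legs {P : D} {χ : ∀ g, P ⟶ (α.ρ g).obj P} {X : EquivariantObject α}
    {p : P ⟶ X.obj} (hp : ∀ g, χ g ≫ (α.ρ g).map p = p ≫ (X.χ g).hom) (g h : G) :
    (χ g ≫ (α.ρ g).map (χ h) ≫ (α.θ g h).hom.app P) ≫ (α.ρ (h * g)).map p =
      χ (h * g) ≫ (α.ρ (h * g)).map p := by
  have nat := (α.θ g h).hom.naturality p
  simp only [Functor.comp_map] at nat
  rw [hp, ← X.cocycle, Category.assoc, Category.assoc, ← nat, ← Functor.map_comp_assoc, hp,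
    Functor.map_comp_assoc, ← Category.assoc, hp, Category.assoc]

theorem comm_of_legs {P : D} {χ : ∀ g, P ⟶ (α.ρ g).obj P} {X S : EquivariantObject α}
    {p : P ⟶ X.obj} (hp : ∀ g, χ g ≫ (α.ρ g).map p = p ≫ (X.χ g).hom)
    {l : S.obj ⟶ P} (s : S ⟶ X) (hl : l ≫ p = s.hom) (g : G) :
    ((S.χ g).hom ≫ (α.ρ g).map l) ≫ (α.ρ g).map p = (l ≫ χ g) ≫ (α.ρ g).map p := by
  rw [Category.assoc, Category.assoc, hp, ← Functor.map_comp, reassoc_of% hl, hl, s.comm]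

theorem cocycle_of_colegs {P : D} {χ : ∀ g, P ⟶ (α.ρ g).obj P} {X : EquivariantObject α}
    {p : X.obj ⟶ P} (hp : ∀ g, p ≫ χ g = (X.χ g).hom ≫ (α.ρ g).map p) (g h : G) :
    p ≫ χ g ≫ (α.ρ g).map (χ h) ≫ (α.θ g h).hom.app P = p ≫ χ (h * g) := by
  have nat := (α.θ g h).hom.naturality p
  simp only [Functor.comp_map] at nat
  rw [hp, ← X.cocycle, reassoc_of% (hp g), ← Functor.map_comp_assoc, hp,
    Functor.map_comp_assoc, Category.assoc, Category.assoc, ← nat]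

theorem comm_of_colegs {P : D} {χ : ∀ g, P ⟶ (α.ρ g).obj P} {X S : EquivariantObject α}
    {p : X.obj ⟶ P} (hp : ∀ g, p ≫ χ g = (X.χ g).hom ≫ (α.ρ g).map p)
    {l : P ⟶ S.obj} (s : X ⟶ S) (hl : p ≫ l = s.hom) (g : G) :
    p ≫ χ g ≫ (α.ρ g).map l = p ≫ l ≫ (S.χ g).hom := by
  rw [reassoc_of% (hp g), ← Functor.map_comp, reassoc_of% hl, hl, s.comm]

variable {J : Type u₁} [Category.{v₁} J] (K : J ⥤ EquivariantObject α)

/-- The linearizations of the objects `K.obj j` as a natural isomorphism. -/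
def natIso (g : G) : K ⋙ forget α ≅ (K ⋙ forget α) ⋙ α.ρ g :=
  NatIso.ofComponents (fun j => (K.obj j).χ g) (fun f => ((K.map f).comm g).symm)

/-- The limit of the underlying diagram, with the induced linearization. -/
noncomputable def limitPt (c : Cone (K ⋙ forget α)) (hc : IsLimit c) : EquivariantObject α where
  obj := c.pt
  χ g := hc.conePointsIsoOfNatIso (isLimitOfPreserves (α.ρ g) hc) (natIso K g)
  cocycle g h := (isLimitOfPreserves (α.ρ (h * g)) hc).hom_ext fun j =>
    cocycle_of_legs (X := K.obj j) (fun g =>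
      IsLimit.conePointsIsoOfNatIso_hom_comp hc (isLimitOfPreserves (α.ρ g) hc) (natIso K g) j) g h

theorem limitPt_comp (c : Cone (K ⋙ forget α)) (hc : IsLimit c) (j : J) (g : G) :
    ((limitPt K c hc).χ g).hom ≫ (α.ρ g).map (c.π.app j) = c.π.app j ≫ ((K.obj j).χ g).hom :=
  IsLimit.conePointsIsoOfNatIso_hom_comp hc (isLimitOfPreserves (α.ρ g) hc) (natIso K g) j

noncomputable instance : CreatesLimit K (forget α) :=
  createsLimitOfReflectsIso fun c hc =>
    { liftedCone :=
        { pt := limitPt K c hc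
          π :=
            { app := fun j => ⟨c.π.app j, fun g => limitPt_comp K c hc j g⟩
              naturality := fun _ _ f => hom_ext (c.π.naturality f) } }
      validLift := Cone.ext (Iso.refl _) (fun _ => (Category.id_comp _).symm)
      makesLimit :=
        { lift := fun s => ⟨hc.lift ((forget α).mapCone s), fun g =>
            (isLimitOfPreserves (α.ρ g) hc).hom_ext fun j =>
              comm_of_legs (X := K.obj j) (limitPt_comp K c hc j) (s.π.app j)
                (hc.fac ((forget α).mapCone s) j) g⟩
          fac := fun s j => hom_ext (hc.fac ((forget α).mapCone s) j)
          uniq := fun s m hm => hom_ext (hc.uniq ((forget α).mapCone s) m.hom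
            (fun _ => congrArg Hom.hom (hm _))) } }

/-- The colimit of the underlying diagram, with the induced linearization. -/
noncomputable def colimitPt (c : Cocone (K ⋙ forget α)) (hc : IsColimit c) :
    EquivariantObject α where
  obj := c.pt
  χ g := hc.coconePointsIsoOfNatIso (isColimitOfPreserves (α.ρ g) hc) (natIso K g)
  cocycle g h := hc.hom_ext fun j =>
    cocycle_of_colegs (X := K.obj j) (fun g =>
      IsColimit.comp_coconePointsIsoOfNatIso_hom hc
        (isColimitOfPreserves (α.ρ g) hc) (natIso K g) j) g h

theorem comp_colimitPt (c : Cocone (K ⋙ forget α)) (hc : IsColimit c) (j : J) (g : G) :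
    c.ι.app j ≫ ((colimitPt K c hc).χ g).hom = ((K.obj j).χ g).hom ≫ (α.ρ g).map (c.ι.app j) :=
  IsColimit.comp_coconePointsIsoOfNatIso_hom hc (isColimitOfPreserves (α.ρ g) hc) (natIso K g) j

noncomputable instance : CreatesColimit K (forget α) :=
  createsColimitOfReflectsIso fun c hc =>
    { liftedCocone :=
        { pt := colimitPt K c hc
          ι :=
            { app := fun j => ⟨c.ι.app j, fun g => (comp_colimitPt K c hc j g).symm⟩
              naturality := fun _ _ f => hom_ext (c.ι.naturality f) } }
      validLift := Cocone.ext (Iso.refl _) (fun _ => Category.comp_id _)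
      makesColimit :=
        { desc := fun s => ⟨hc.desc ((forget α).mapCocone s), fun g =>
            hc.hom_ext fun j =>
              comm_of_colegs (X := K.obj j) (comp_colimitPt K c hc j) (s.ι.app j)
                (hc.fac ((forget α).mapCocone s) j) g⟩
          fac := fun s j => hom_ext (hc.fac ((forget α).mapCocone s) j)
          uniq := fun s m hm => hom_ext (hc.uniq ((forget α).mapCocone s) m.hom
            (fun _ => congrArg Hom.hom (hm _))) } }

end Limits

section Abelian

variable {G : Type w} [Group G] {D : Type u} [Category.{v} D] [Abelian D] {α : RightAction G D}

instance (g : G) : (α.ρ g).Additive := (α.ρ g).additive_of_preserves_binary_products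

instance (X Y : EquivariantObject α) : Zero (X ⟶ Y) := ⟨⟨0, fun g => by simp⟩⟩

instance (X Y : EquivariantObject α) : Add (X ⟶ Y) :=
  ⟨fun f f' => ⟨f.hom + f'.hom, fun g => by simp [f.comm, f'.comm]⟩⟩

instance (X Y : EquivariantObject α) : Neg (X ⟶ Y) :=
  ⟨fun f => ⟨-f.hom, fun g => by simp [f.comm]⟩⟩

instance (X Y : EquivariantObject α) : AddCommGroup (X ⟶ Y) where
  add_assoc f f' f'' := hom_ext (add_assoc f.hom f'.hom f''.hom)
  zero_add f := hom_ext (zero_add f.hom)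
  add_zero f := hom_ext (add_zero f.hom)
  add_comm f f' := hom_ext (add_comm f.hom f'.hom)
  neg_add_cancel f := hom_ext (neg_add_cancel f.hom)
  nsmul := nsmulRec
  zsmul := zsmulRec

instance : Preadditive (EquivariantObject α) where
  add_comp _ _ _ f f' f'' := hom_ext (Preadditive.add_comp _ _ _ f.hom f'.hom f''.hom)
  comp_add _ _ _ f f' f'' := hom_ext (Preadditive.comp_add _ _ _ f.hom f'.hom f''.hom)

instance : (forget α).Additive where
  map_add := rfl

instance : HasFiniteLimits (EquivariantObject α) where
  out _ _ _ := ⟨fun K => hasLimit_of_created K (forget α)⟩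

instance : HasFiniteColimits (EquivariantObject α) where
  out _ _ _ := ⟨fun K => hasColimit_of_created K (forget α)⟩

instance : PreservesFiniteLimits (forget α) where
  preservesFiniteLimits _ _ _ := ⟨fun {_} => inferInstance⟩

instance : PreservesFiniteColimits (forget α) where
  preservesFiniteColimits _ _ _ := ⟨fun {_} => inferInstance⟩

instance {X Y : EquivariantObject α} (f : X ⟶ Y) : IsIso (Abelian.coimageImageComparison f) := by
  have h : IsIso ((forget α).map (Abelian.coimageImageComparison f)) :=
    (Arrow.isIso_iff_isIso_of_isIso
      (Abelian.PreservesCoimageImageComparison.iso (forget α) f).inv).1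
        (inferInstanceAs (IsIso (Abelian.coimageImageComparison ((forget α).map f))))
  exact isIso_of_reflects_iso _ (forget α)

/-- The equivariant category of an abelian category is abelian. -/
noncomputable instance : Abelian (EquivariantObject α) :=
  Abelian.ofCoimageImageComparisonIsIso

end Abelian

end EquivariantObject

section Functors

variable {G : Type w} [Group G] {A : Type u₁} [Category.{v₁} A] {B : Type u₂} [Category.{v₂} B]

/-- The structure of a `G`-functor on `F`: natural isomorphisms `σ g : F ∘ ρ_g ≅ ρ'_g ∘ F`
compatible with the composition isomorphisms. -/
structure GFunctorStructure (α : RightAction G A) (β : RightAction G B) (F : A ⥤ B) where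
  σ : ∀ g, α.ρ g ⋙ F ≅ F ⋙ β.ρ g
  assoc : ∀ (g h : G) (X : A),
    F.map ((α.θ g h).hom.app X) ≫ (σ (h * g)).hom.app X =
      (σ g).hom.app ((α.ρ h).obj X) ≫ (β.ρ g).map ((σ h).hom.app X) ≫
        (β.θ g h).hom.app (F.obj X)

/-- The equivariant functor `F^G : A^G ⥤ B^G`, `(X, χ) ↦ (F X, (σ_g ∘ F χ_g)_g)`. -/
def equivariantFunctor {α : RightAction G A} {β : RightAction G B} {F : A ⥤ B}
    (s : GFunctorStructure α β F) : EquivariantObject α ⥤ EquivariantObject β where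
  obj X :=
    { obj := F.obj X.obj
      χ := fun g => F.mapIso (X.χ g) ≪≫ (s.σ g).app X.obj
      cocycle := fun g h => by
        have nat := (s.σ g).hom.naturality (X.χ h).hom
        have e := s.assoc g h X.obj
        simp only [Functor.comp_map] at nat
        simp only [Iso.trans_hom, Functor.mapIso_hom, Iso.app_hom, Functor.map_comp,
          Category.assoc]
        rw [← reassoc_of% nat, ← e, ← X.cocycle g h]
        simp only [Functor.map_comp, Category.assoc] }
  map f := ⟨F.map f.hom, fun g => by
    have nat := (s.σ g).hom.naturality f.hom
    simp only [Functor.comp_map] at nat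
    simp only [Iso.trans_hom, Functor.mapIso_hom, Iso.app_hom, Category.assoc]
    rw [← nat, ← F.map_comp_assoc, f.comm, F.map_comp_assoc]⟩
  map_id X := EquivariantObject.hom_ext (F.map_id X.obj)
  map_comp f f' := EquivariantObject.hom_ext (F.map_comp f.hom f'.hom)

/-- A functor `F` between abelian categories is a `k`-homological embedding if it is exact and the
induced maps `Ext^n(X, Y) → Ext^n(F X, F Y)` are bijective for all `X`, `Y` and `0 ≤ n ≤ k`. -/
def IsHomologicalEmbedding [Abelian A] [Abelian B] (F : A ⥤ B) (k : ℕ) : Prop :=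
  ∃ (_ : F.Additive) (_ : PreservesFiniteLimits F) (_ : PreservesFiniteColimits F),
    haveI : HasExt.{max u₁ v₁} A := HasExt.standard A
    haveI : HasExt.{max u₂ v₂} B := HasExt.standard B
    ∀ (X Y : A) (n : ℕ), n ≤ k → Function.Bijective (F.mapExtAddHom X Y n)

end Functors

/-- `n` is invertible in a preadditive category: every morphism is divisible by `n`. -/
def IsInvertibleIn (n : ℕ) (D : Type u) [Category.{v} D] [Preadditive D] : Prop :=
  ∀ (X Y : D) (f : X ⟶ Y), ∃ f' : X ⟶ Y, f = n • f'

/-- A recollement of abelian categories. -/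
structure AbelianRecollement (A : Type u₁) [Category.{v₁} A] [Abelian A]
    (B : Type u₂) [Category.{v₂} B] [Abelian B]
    (C : Type u₃) [Category.{v₃} C] [Abelian C] where
  i : A ⥤ B
  q : B ⥤ A
  p : B ⥤ A
  e : B ⥤ C
  l : C ⥤ B
  r : C ⥤ B
  adjQI : q ⊣ i
  adjIP : i ⊣ p
  adjLE : l ⊣ e
  adjER : e ⊣ r
  i_full : i.Full
  i_faithful : i.Faithful
  l_full : l.Full
  l_faithful : l.Faithful
  r_full : r.Full
  r_faithful : r.Faithful
  image_eq_kernel : ∀ Y : B, i.essImage Y ↔ IsZero (e.obj Y)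

/-- The recollement lifts to a `G`-equivariant recollement along an action on `B`: either `G` acts
on `C` such that `e` is a `G`-functor, or `A` (i.e. the essential image of `i`) is a `G`-invariant
subcategory of `B`. -/
def AbelianRecollement.LiftsToEquivariant {G : Type w} [Group G]
    {A : Type u₁} [Category.{v₁} A] [Abelian A]
    {B : Type u₂} [Category.{v₂} B] [Abelian B]
    {C : Type u₃} [Category.{v₃} C] [Abelian C]
    (R : AbelianRecollement A B C) (β : RightAction G B) : Prop :=
  (∃ γ : RightAction G C, Nonempty (GFunctorStructure β γ R.e)) ∨
    ∀ (g : G) (X : A), R.i.essImage ((β.ρ g).obj (R.i.obj X))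

end Equivariant

/-! Everything rests on the exact forgetful functor from equivariant objects and its right adjoint,
coinduction $Y \mapsto \prod_h \rho_h Y$. Because the forgetful functor is exact, the adjunction
extends to $\mathrm{Ext}^n(W, \mathrm{Coind}\,Y) \cong \mathrm{Ext}^n(W, Y)$
(`IsCoinduced.bijective_extAdj`); effaceability of Ext replaces resolutions there. A $G$-functor
preserving finite products carries coinduced objects to coinduced objects, so on pairs $(W,
\mathrm{Coind}\,Y)$ the comparison map of $F^G$ is that of $F$ on $(W, Y)$
(`bijective_mapExtAddHom_iff_of_isCoinduced`).

Upwards, every equivariant object embeds into a coinduced one, and dimension shifting reaches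
arbitrary second arguments (`bijective_mapExtAddHom_equivariantFunctor`). Downwards, every $X$ is a
retract of the object underlying its coinduced object, and bijectivity passes to retracts
(`bijective_mapExtAddHom_of_equivariantFunctor`).

For a recollement, the kernel of $e$ is stable under the action, so the action restricts along the
fully faithful $i$, which is exact because it has adjoints on both sides. -/

namespace CategoryTheory.Abelian.Ext

/-! ### Effaceability of Ext classes -/

section Effacement

variable {C : Type u} [Category.{v} C] [Abelian C]

/-- The degree-0 cycles of `K` map onto $H^0(K)$, which `s` identifies with $H^0$ of the single
complex, that is, with its degree-0 term. So `s.f 0` is already epi on cycles. -/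
lemma epi_f_zero_of_quasiIso_single {X : C} {K : CochainComplex C ℤ} [K.IsStrictlyLE 0]
    (s : K ⟶ (CochainComplex.singleFunctor C 0).obj X) [QuasiIso s] : Epi (s.f 0) := by
  let L := (CochainComplex.singleFunctor C 0).obj X
  have hd : L.d (-1) 0 = 0 :=
    IsZero.eq_of_src (HomologicalComplex.isZero_single_obj_X _ _ _ _ (by simp)) _ _
  have h1 : IsIso (L.homologyπ 0) := L.isIso_homologyπ (-1) 0 (by simp) hd
  have h2 : IsIso (L.iCycles 0) := L.isIso_iCycles 0 1 (by simp)
    (IsZero.eq_of_tgt (HomologicalComplex.isZero_single_obj_X _ _ _ _ (by simp)) _ _)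
  have e1 := HomologicalComplex.homologyπ_naturality s 0
  have : Epi (HomologicalComplex.cyclesMap s 0) := by
    have : Epi (HomologicalComplex.cyclesMap s 0 ≫ L.homologyπ 0) := by
      rw [← e1]; infer_instance
    have h3 := epi_comp (HomologicalComplex.cyclesMap s 0 ≫ L.homologyπ 0) (inv (L.homologyπ 0))
    simpa using h3
  have e2 := HomologicalComplex.cyclesMap_i s 0
  have : Epi (K.iCycles 0 ≫ s.f 0) := by rw [← e2]; exact epi_comp _ (L.iCycles 0)
  exact epi_of_epi (K.iCycles 0) (s.f 0)

lemma mkHomFromSingle_id_comp {ι : Type*} [DecidableEq ι] {c : ComplexShape ι} {i : ι} {X : C}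
    {K : HomologicalComplex C c} (h : ∀ k, c.Rel i k → 𝟙 (K.X i) ≫ K.d i k = 0)
    (s : K ⟶ (HomologicalComplex.single C c i).obj X) :
    HomologicalComplex.mkHomFromSingle (𝟙 (K.X i)) h ≫ s =
      (HomologicalComplex.single C c i).map
        (s.f i ≫ (HomologicalComplex.singleObjXSelf c i X).hom) := by
  apply HomologicalComplex.from_single_hom_ext
  simp [HomologicalComplex.single_map_f_self]

open _root_.DerivedCategory in
/-- Every extension class of positive degree is effaced by an epimorphism. -/
lemma exists_epi_mk₀_comp_eq_zero [HasExt.{w} C] {X Y : C} {n : ℕ} (x : Ext X Y (n + 1)) :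
    ∃ (P : C) (p : P ⟶ X), Epi p ∧ (mk₀ p).comp x (zero_add _) = 0 := by
  let := HasDerivedCategory.standard C
  let KX := (CochainComplex.singleFunctor C 0).obj X
  let KY := (CochainComplex.singleFunctor C 0).obj Y
  let x' : Q.obj KX ⟶ Q.obj (KY⟦((n + 1 : ℕ) : ℤ)⟧) :=
    x.hom ≫ (Q.commShiftIso ((n + 1 : ℕ) : ℤ)).inv.app KY
  -- The class becomes a fraction $Q(s)^{-1}Q(g)$ with `s` a quasi-isomorphism from a complex in
  -- degrees ≤ 0; the degree-0 part of `s` is the effacing epimorphism.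
  obtain ⟨K, hK, s, hs, g, hx⟩ := right_fac_of_isStrictlyLE x' 0
  rw [isIso_Q_map_iff_quasiIso] at hs
  have hp := epi_f_zero_of_quasiIso_single s
  let e : KX.X 0 ≅ X := HomologicalComplex.singleObjXSelf (ComplexShape.up ℤ) 0 X
  let p : K.X 0 ⟶ X := s.f 0 ≫ e.hom
  let j : (CochainComplex.singleFunctor C 0).obj (K.X 0) ⟶ K :=
    HomologicalComplex.mkHomFromSingle (𝟙 _) (fun k hk =>
      IsZero.eq_of_tgt (K.isZero_of_isStrictlyLE 0 k (by simp at hk; lia)) _ _)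
  have hj : j ≫ s = (CochainComplex.singleFunctor C 0).map p := mkHomFromSingle_id_comp _ s
  -- Positivity of the degree enters here: the target of `g` is concentrated in degree $-(n+1) \neq
  -- 0$, whereas `j` starts from degree 0.
  have hg : j ≫ g = 0 := by
    apply HomologicalComplex.from_single_hom_ext
    refine IsZero.eq_of_tgt
      (HomologicalComplex.isZero_single_obj_X (ComplexShape.up ℤ) 0 Y (0 + ((n + 1 : ℕ) : ℤ)) ?_)
      _ _
    lia
  refine ⟨K.X 0, p, epi_comp (s.f 0) e.hom, ?_⟩
  ext
  rw [← singleFunctor_map_comp_hom, zero_hom]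
  have hs' : IsIso (Q.map s) := by rwa [isIso_Q_map_iff_quasiIso]
  have h1 : Q.map ((CochainComplex.singleFunctor C 0).map p) ≫ x' = 0 := by
    rw [← hj, hx, Functor.map_comp, Category.assoc, IsIso.hom_inv_id_assoc, ← Functor.map_comp,
      hg, Functor.map_zero]
  have h2 : x.hom = x' ≫ (Q.commShiftIso ((n + 1 : ℕ) : ℤ)).hom.app KY :=
    ((Category.assoc _ _ _).trans ((congrArg (x.hom ≫ ·)
      ((Q.commShiftIso ((n + 1 : ℕ) : ℤ)).inv_hom_id_app KY)).trans (Category.comp_id _))).symm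
  rw [h2]
  exact (Category.assoc _ _ _).symm.trans
    ((congrArg (· ≫ (Q.commShiftIso ((n + 1 : ℕ) : ℤ)).hom.app KY) h1).trans Limits.zero_comp)

/-- Effacing a class of positive degree and applying the long exact sequence factors it through the
class of a short exact sequence. Iterating is Yoneda splicing, so multiplicative statements need
checking only on morphisms and on `extClass`. -/
lemma induction_on_extClass [HasExt.{w} C]
    {motive : ∀ {X Y : C} {n : ℕ}, Ext X Y n → Prop}
    (zero : ∀ {X Y : C} (f : X ⟶ Y), motive (mk₀ f))
    (succ : ∀ {S : ShortComplex C} (hS : S.ShortExact) {Y : C} {n : ℕ} (y : Ext S.X₁ Y n),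
      motive y → motive (hS.extClass.comp y (add_comm 1 n)))
    {X Y : C} {n : ℕ} (x : Ext X Y n) : motive x := by
  induction n generalizing X with
  | zero => obtain ⟨f, rfl⟩ := (mk₀_bijective X Y).2 x; exact zero f
  | succ n ih =>
    obtain ⟨P, p, _, hp⟩ := exists_epi_mk₀_comp_eq_zero x
    let S := ShortComplex.mk _ _ (kernel.condition p)
    have hS : S.ShortExact := { exact := ShortComplex.exact_kernel p }
    obtain ⟨y, rfl⟩ := contravariant_sequence_exact₃ hS Y x hp (add_comm 1 n)
    exact succ hS y (ih y)

end Effacement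

/-! ### Ext maps of composite exact functors -/

section Comp

variable {C : Type u₁} [Category.{v₁} C] [Abelian C] {D : Type u₂} [Category.{v₂} D] [Abelian D]
  {E : Type u₃} [Category.{v₃} E] [Abelian E]

lemma mapExactFunctor_mapExactFunctor (F : C ⥤ D) [F.Additive] [PreservesFiniteLimits F]
    [PreservesFiniteColimits F] (F' : D ⥤ E) [F'.Additive] [PreservesFiniteLimits F']
    [PreservesFiniteColimits F']
    [HasExt.{w} C] [HasExt.{v} D] [HasExt.{u} E] {X Y : C} {n : ℕ} (x : Ext X Y n) :
    (x.mapExactFunctor F).mapExactFunctor F' = x.mapExactFunctor (F ⋙ F') := by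
  induction x using induction_on_extClass with
  | zero f => simp only [mapExactFunctor_mk₀]; rfl
  | succ hS y ih =>
    rw [mapExactFunctor_comp, mapExactFunctor_comp, mapExactFunctor_comp, ih,
      mapExactFunctor_extClass]
    refine congrArg (Ext.comp · _ _) ?_
    exact (mapExactFunctor_extClass F' (hS.map_of_exact F)).trans
      (mapExactFunctor_extClass (F ⋙ F') hS).symm

end Comp

end CategoryTheory.Abelian.Ext

namespace CategoryTheory.Limits

/-! ### Products presented by their projections -/

section ProductFan

variable {C : Type u} [Category.{v} C] {D : Type u₁} [Category.{v₁} D] {I : Type w}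

/-- The family of morphisms `π i : P ⟶ f i` exhibits `P` as a product of the `f i`. -/
def IsProductFan {P : C} {f : I → C} (π : ∀ i, P ⟶ f i) : Prop :=
  Nonempty (IsLimit (Fan.mk P π))

namespace IsProductFan

variable {P Q : C} {f f' : I → C} {π : ∀ i, P ⟶ f i}

lemma exists_lift (h : IsProductFan π) {T : C} (k : ∀ i, T ⟶ f i) :
    ∃ l : T ⟶ P, ∀ i, l ≫ π i = k i :=
  ⟨Fan.IsLimit.lift h.some k, fun i => Fan.IsLimit.fac h.some k i⟩

lemma hom_ext (h : IsProductFan π) {T : C} {l l' : T ⟶ P} (hl : ∀ i, l ≫ π i = l' ≫ π i) :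
    l = l' :=
  Fan.IsLimit.hom_ext h.some _ _ hl

lemma of_lift (ex : ∀ (T : C) (k : ∀ i, T ⟶ f i), ∃ l : T ⟶ P, ∀ i, l ≫ π i = k i)
    (uniq : ∀ (T : C) (l l' : T ⟶ P), (∀ i, l ≫ π i = l' ≫ π i) → l = l') : IsProductFan π :=
  ⟨Fan.IsLimit.mk _ (fun s => (ex s.pt s.proj).choose) (fun s => (ex s.pt s.proj).choose_spec)
    fun _ _ hm => uniq _ _ _ fun i => (hm i).trans ((ex _ _).choose_spec i).symm⟩

lemma comp_iso (h : IsProductFan π) (e : ∀ i, f i ≅ f' i) :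
    IsProductFan fun i => π i ≫ (e i).hom :=
  of_lift
    (fun T k => by
      obtain ⟨l, hl⟩ := h.exists_lift fun i => k i ≫ (e i).inv
      exact ⟨l, fun i => by simp [reassoc_of% (hl i)]⟩)
    fun T l l' hl => h.hom_ext fun i => by
      simpa only [← Category.assoc, cancel_mono] using hl i

lemma reindex (h : IsProductFan π) {J : Type u₂} (e : J ≃ I) :
    IsProductFan fun j => π (e j) := by
  refine of_lift (fun T k => ?_) fun T l l' hl => h.hom_ext fun i => ?_
  · have hk (i : I) : ∃ k' : T ⟶ f i, ∀ j (hj : e j = i), k j = k' ≫ eqToHom (by rw [hj]) := by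
      obtain ⟨j, rfl⟩ := e.surjective i
      refine ⟨k j, fun j' hj => ?_⟩
      obtain rfl := e.injective hj
      simp
    choose k' hk' using hk
    obtain ⟨l, hl⟩ := h.exists_lift k'
    exact ⟨l, fun j => by rw [hl, hk' _ j rfl]; simp⟩
  · obtain ⟨j, rfl⟩ := e.surjective i
    exact hl j

lemma map (h : IsProductFan π) (F : C ⥤ D) [PreservesLimit (Discrete.functor f) F] :
    IsProductFan fun i => F.map (π i) :=
  ⟨isLimitFanMkObjOfIsLimit F _ _ h.some⟩

lemma of_hasProduct (f : I → C) [HasProduct f] : IsProductFan (Pi.π f) :=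
  ⟨productIsProduct f⟩

lemma exists_iso {π' : ∀ i, Q ⟶ f i} (h : IsProductFan π) (h' : IsProductFan π') :
    ∃ e : P ≅ Q, ∀ i, e.hom ≫ π' i = π i := by
  obtain ⟨a, ha⟩ := h'.exists_lift π
  obtain ⟨b, hb⟩ := h.exists_lift π'
  exact ⟨⟨a, b, h.hom_ext fun i => by simp [ha, hb], h'.hom_ext fun i => by simp [ha, hb]⟩, ha⟩

lemma isSplitEpi [HasZeroMorphisms C] (h : IsProductFan π) (i : I) : IsSplitEpi (π i) := by
  classical
  obtain ⟨l, hl⟩ := h.exists_lift fun j => if hj : i = j then eqToHom (congrArg f hj) else 0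
  exact ⟨⟨⟨l, by simp [hl]⟩⟩⟩

/-- Finite products in a preadditive category are biproducts, so a product of epimorphisms is an
epimorphism. -/
lemma epi_of_comp_eq [Preadditive C] [HasFiniteProducts C] [Finite I] (h : IsProductFan π)
    {π' : ∀ i, Q ⟶ f' i} (h' : IsProductFan π') (p : ∀ i, f i ⟶ f' i) [∀ i, Epi (p i)]
    (φ : P ⟶ Q) (hφ : ∀ i, φ ≫ π' i = π i ≫ p i) : Epi φ := by
  have := HasFiniteBiproducts.of_hasFiniteProducts (C := C)
  obtain ⟨e, he⟩ := h.exists_iso (of_hasProduct f)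
  obtain ⟨e', he'⟩ := h'.exists_iso (of_hasProduct f')
  have : φ = e.hom ≫ Pi.map p ≫ e'.inv := by
    rw [← Category.assoc, Iso.eq_comp_inv]
    refine Pi.hom_ext _ _ fun i => ?_
    simp [he', hφ, reassoc_of% (he i)]
  rw [this]
  infer_instance

end IsProductFan

end ProductFan

end CategoryTheory.Limits

namespace Equivariant

namespace EquivariantObject

/-! ### Coinduced equivariant objects -/

section Coinduced

variable {G : Type w} [Group G] {D : Type u} [Category.{v} D] {α : RightAction G D}

/-- The equivariant object `J` is coinduced from `Y` along `ε : J.obj ⟶ Y`: the morphisms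
`ρ_h(ε) ∘ χ_h` exhibit `J.obj` as the product of the objects `ρ_h Y`. -/
def IsCoinduced (J : EquivariantObject α) {Y : D} (ε : J.obj ⟶ Y) : Prop :=
  IsProductFan fun h : G => (J.χ h).hom ≫ (α.ρ h).map ε

/-- Equivariance forces the `h`-th component of `φ` to be $\rho_h(\varepsilon\varphi)\circ\chi_h$.
With `exists_lift` this is the universal property of the right adjoint of `forget`, with counit `ε`.
-/
lemma IsCoinduced.hom_ext {J : EquivariantObject α} {Y : D} {ε : J.obj ⟶ Y}
    (hJ : IsCoinduced J ε) {W : EquivariantObject α} {φ ψ : W ⟶ J}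
    (h : φ.hom ≫ ε = ψ.hom ≫ ε) : φ = ψ := by
  refine EquivariantObject.hom_ext (IsProductFan.hom_ext hJ fun g => ?_)
  rw [← Category.assoc, ← Category.assoc, ← φ.comm, ← ψ.comm, Category.assoc, Category.assoc,
    ← Functor.map_comp, ← Functor.map_comp, h]

lemma IsCoinduced.exists_lift {J : EquivariantObject α} {Y : D} {ε : J.obj ⟶ Y}
    (hJ : IsCoinduced J ε) {W : EquivariantObject α} (f : W.obj ⟶ Y) :
    ∃ φ : W ⟶ J, φ.hom ≫ ε = f := by
  obtain ⟨l, hl⟩ := IsProductFan.exists_lift hJ fun h => (W.χ h).hom ≫ (α.ρ h).map f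
  have comm (g : G) : (W.χ g).hom ≫ (α.ρ g).map l = l ≫ (J.χ g).hom := by
    -- Through `θ`, $\rho_g J$ is the product of the $\rho_{hg} Y$, so equivariance of `l` can be
    -- tested componentwise with the two cocycle identities.
    have hg := (IsProductFan.map hJ (α.ρ g)).comp_iso fun h => (α.θ g h).app Y
    refine hg.hom_ext fun h => ?_
    have n1 := (α.θ g h).hom.naturality ε
    have n2 := (α.θ g h).hom.naturality f
    simp only [Functor.comp_map] at n1 n2
    have lhs : (W.χ g).hom ≫ (α.ρ g).map l ≫ (α.ρ g).map ((J.χ h).hom ≫ (α.ρ h).map ε) ≫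
        (α.θ g h).hom.app Y = (W.χ (h * g)).hom ≫ (α.ρ (h * g)).map f := by
      rw [← Functor.map_comp_assoc, hl, Functor.map_comp_assoc, n2, reassoc_of% (W.cocycle g h)]
    have rhs : l ≫ (J.χ g).hom ≫ (α.ρ g).map ((J.χ h).hom ≫ (α.ρ h).map ε) ≫
        (α.θ g h).hom.app Y = (W.χ (h * g)).hom ≫ (α.ρ (h * g)).map f := by
      rw [Functor.map_comp_assoc, n1, reassoc_of% (J.cocycle g h), hl]
    simpa only [Iso.app_hom, Category.assoc] using lhs.trans rhs.symm
  -- The component of `l` at 1 gives the counit identity only after applying $\rho_1$, which is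
  -- faithful.
  refine ⟨⟨l, comm⟩, (α.ρ 1).map_injective ?_⟩
  rw [← cancel_epi (W.χ 1).hom, ← hl, Functor.map_comp, reassoc_of% (comm 1)]

lemma exists_isCoinduced [Finite G] [HasFiniteProducts D] (Y : D) :
    ∃ (J : EquivariantObject α) (ε : J.obj ⟶ Y), IsCoinduced J ε := by
  -- As $\rho_1$ need not be the identity, the product is formed from `Z` with $\rho_1 Z \cong Y$;
  -- its projection at 1 then gives the counit.
  let Z := (α.ρ 1).objPreimage Y
  let e : (α.ρ 1).obj Z ≅ Y := (α.ρ 1).objObjPreimageIso Y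
  have hπ := IsProductFan.of_hasProduct fun h : G => (α.ρ h).obj Z
  set P := ∏ᶜ fun h : G => (α.ρ h).obj Z
  set π : ∀ h, P ⟶ (α.ρ h).obj Z := Pi.π _
  have hρ (g : G) : IsProductFan fun h => (α.ρ g).map (π h) ≫ (α.θ g h).hom.app Z :=
    (hπ.map (α.ρ g)).comp_iso fun h => (α.θ g h).app Z
  -- The linearization permutes factors: the `h`-th factor of $\rho_g P$ is $\rho_{hg} Z$, matched
  -- with the projection of `P` at `h * g`.
  choose χ hχ using fun g => IsProductFan.exists_iso (hπ.reindex (Equiv.mulRight g)) (hρ g)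
  simp only [Equiv.coe_mulRight] at hχ
  have π_eq {a b : G} (h : a = b) : π a ≫ eqToHom (by rw [h]) = π b := by subst h; simp
  let J : EquivariantObject α :=
    { obj := P
      χ := χ
      cocycle := fun g h => (hρ (h * g)).hom_ext fun k => by
        have n1 := (α.θ g h).hom.naturality (π k)
        simp only [Functor.comp_map] at n1
        simp only [Category.assoc]
        rw [hχ, ← reassoc_of% n1, ← α.cocycle, ← Functor.map_comp_assoc, ← Functor.map_comp_assoc,
          Category.assoc, hχ, reassoc_of% (hχ g (k * h))]
        exact π_eq (mul_assoc k h g) }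
  refine ⟨J, π 1 ≫ e.hom, ?_⟩
  have key := hπ.comp_iso fun h : G => eqToIso (by rw [one_mul]) ≪≫ ((α.θ h 1).app Z).symm ≪≫
    (α.ρ h).mapIso e
  have hε : (fun h => (J.χ h).hom ≫ (α.ρ h).map (π 1 ≫ e.hom)) = fun h => π h ≫
      (eqToIso (by rw [one_mul]) ≪≫ ((α.θ h 1).app Z).symm ≪≫ (α.ρ h).mapIso e).hom := by
    funext h
    rw [← π_eq (one_mul h)]
    simp [J, ← hχ]
  unfold IsCoinduced
  rw [hε]
  exact key

end Coinduced

end EquivariantObject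

end Equivariant

universe t t₁ t₂ t₃

namespace Equivariant

open EquivariantObject CategoryTheory.Abelian

namespace EquivariantObject

section Exactness

variable {G : Type w} [Group G] {D : Type u} [Category.{v} D] {α : RightAction G D}

instance [HasFiniteLimits D] : ReflectsFiniteLimits (forget α) where
  reflects _ _ _ := ⟨fun {K} =>
    have : HasLimit K := hasLimit_of_created K (forget α)
    reflectsLimit_of_reflectsIsomorphisms K (forget α)⟩

instance [HasFiniteColimits D] : ReflectsFiniteColimits (forget α) where
  reflects _ _ _ := ⟨fun {K} =>
    have : HasColimit K := hasColimit_of_created K (forget α)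
    reflectsColimit_of_reflectsIsomorphisms K (forget α)⟩

end Exactness

/-! ### The coinduction adjunction on Ext -/

section Ext

variable {G : Type w} [Group G] {D : Type u} [Category.{v} D] [Abelian D] {α : RightAction G D}

/-- Morphisms into a coinduced object can be used to dominate epimorphisms of `D` by epimorphisms
of the equivariant category. -/
lemma exists_epi_factor [Finite G] {W : EquivariantObject α} {P : D} (p : P ⟶ W.obj) [Epi p] :
    ∃ (Q : EquivariantObject α) (q : Q ⟶ W) (r : Q.obj ⟶ P), Epi q ∧ r ≫ p = q.hom := by
  obtain ⟨J₁, ε₁, h₁⟩ := exists_isCoinduced (α := α) P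
  obtain ⟨J₂, ε₂, h₂⟩ := exists_isCoinduced (α := α) W.obj
  obtain ⟨φ, hφ⟩ := h₂.exists_lift (ε₁ ≫ p)
  obtain ⟨η, hη⟩ := h₂.exists_lift (𝟙 W.obj)
  have : Epi φ.hom := IsProductFan.epi_of_comp_eq h₁ h₂ (fun h => (α.ρ h).map p) φ.hom fun h => by
    rw [← Category.assoc, ← φ.comm, Category.assoc, Category.assoc, ← Functor.map_comp,
      ← Functor.map_comp, hφ]
  have : Epi φ := (forget α).epi_of_epi_map this
  -- `φ` is the map coinduced from `p`, hence epi; pulling it back along the unit `η` gives the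
  -- equivariant epimorphism.
  refine ⟨pullback η φ, pullback.fst η φ, (pullback.snd η φ).hom ≫ ε₁, inferInstance, ?_⟩
  rw [Category.assoc, ← hφ, ← Category.assoc, ← comp_hom, ← pullback.condition, comp_hom,
    Category.assoc, hη, Category.comp_id]

lemma exists_mono_isCoinduced [Finite G] (W : EquivariantObject α) :
    ∃ (J : EquivariantObject α) (ε : J.obj ⟶ W.obj) (η : W ⟶ J), IsCoinduced J ε ∧ Mono η := by
  obtain ⟨J, ε, hJ⟩ := exists_isCoinduced (α := α) W.obj
  obtain ⟨η, hη⟩ := hJ.exists_lift (𝟙 W.obj)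
  have : Mono (η.hom ≫ ε) := by rw [hη]; infer_instance
  exact ⟨J, ε, η, hJ, (forget α).mono_of_mono_map (mono_of_mono η.hom ε)⟩

/-- Up to $\chi_1$, $\rho_1(\varepsilon)$ is a product projection, split by zeros in the other
components; full faithfulness of $\rho_1$ brings the section back to `D`. -/
lemma IsCoinduced.isSplitEpi {J : EquivariantObject α} {Y : D} {ε : J.obj ⟶ Y}
    (hJ : IsCoinduced J ε) : IsSplitEpi ε := by
  have h := IsProductFan.isSplitEpi hJ 1
  refine ⟨⟨⟨(α.ρ 1).preimage (section_ ((J.χ 1).hom ≫ (α.ρ 1).map ε) ≫ (J.χ 1).hom),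
    (α.ρ 1).map_injective ?_⟩⟩⟩
  rw [Functor.map_comp, Functor.map_preimage, Category.assoc, CategoryTheory.Functor.map_id]
  exact IsSplitEpi.id ((J.χ 1).hom ≫ (α.ρ 1).map ε)

variable [HasExt.{t} D] [HasExt.{t₁} (EquivariantObject α)]

/-- The adjunction map `Ext^n(W, J) → Ext^n(W.obj, Y)` for `ε : J.obj ⟶ Y`. -/
noncomputable def extAdj (W : EquivariantObject α) {J : EquivariantObject α} {Y : D}
    (ε : J.obj ⟶ Y) (n : ℕ) : Ext.{t₁} W J n →+ Ext.{t} W.obj Y n :=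
  ((Ext.mk₀ ε).postcomp W.obj (add_zero n)).comp ((forget α).mapExtAddHom W J n)

lemma extAdj_apply {W : EquivariantObject α} {J : EquivariantObject α} {Y : D}
    (ε : J.obj ⟶ Y) {n : ℕ} (x : Ext.{t₁} W J n) :
    (extAdj W ε n x : Ext.{t} W.obj Y n) =
      (x.mapExactFunctor (forget α)).comp (Ext.mk₀ ε) (add_zero n) := rfl

lemma extAdj_extClass_comp {S : ShortComplex (EquivariantObject α)} (hS : S.ShortExact)
    {J : EquivariantObject α} {Y : D} (ε : J.obj ⟶ Y) {n m : ℕ} (h : 1 + n = m)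
    (x : Ext.{t₁} S.X₁ J n) :
    (extAdj S.X₃ ε m (hS.extClass.comp x h) : Ext.{t} _ _ _) =
      (hS.map_of_exact (forget α)).extClass.comp (extAdj S.X₁ ε n x) h := by
  rw [extAdj_apply, Ext.mapExactFunctor_comp, Ext.mapExactFunctor_extClass]
  exact Ext.comp_assoc_of_third_deg_zero _ _ _ _

lemma extAdj_mk₀_comp {V W : EquivariantObject α} (f : V ⟶ W)
    {J : EquivariantObject α} {Y : D} (ε : J.obj ⟶ Y) {n : ℕ} (x : Ext.{t₁} W J n) :
    (extAdj V ε n ((Ext.mk₀ f).comp x (zero_add n)) : Ext.{t} _ _ _) =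
      (Ext.mk₀ f.hom).comp (extAdj W ε n x) (zero_add n) := by
  rw [extAdj_apply, Ext.mapExactFunctor_comp, Ext.mapExactFunctor_mk₀]
  exact Ext.comp_assoc_of_third_deg_zero _ _ _ _

/-- Degree 0 is the universal property of `J`. Higher degrees follow by effacing classes in the
first variable and comparing the long exact sequences upstairs and downstairs. -/
theorem IsCoinduced.bijective_extAdj [Finite G] {J : EquivariantObject α} {Y : D} {ε : J.obj ⟶ Y}
    (hJ : IsCoinduced J ε) (W : EquivariantObject α) (n : ℕ) :
    Function.Bijective (extAdj W ε n : Ext.{t₁} W J n → Ext.{t} W.obj Y n) := by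
  induction n generalizing W with
  | zero =>
    have hmk (f : W ⟶ J) : (extAdj W ε 0 (Ext.mk₀ f) : Ext.{t} _ _ _) =
        Ext.mk₀ (f.hom ≫ ε) := by
      rw [extAdj_apply, Ext.mapExactFunctor_mk₀]
      exact Ext.mk₀_comp_mk₀ _ _
    constructor
    · intro x y hxy
      obtain ⟨f, rfl⟩ := (Ext.mk₀_bijective _ _).2 x
      obtain ⟨g, rfl⟩ := (Ext.mk₀_bijective _ _).2 y
      rw [hmk, hmk] at hxy
      rw [hJ.hom_ext ((Ext.mk₀_bijective _ _).1 hxy)]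
    · intro y
      obtain ⟨f, rfl⟩ := (Ext.mk₀_bijective _ _).2 y
      obtain ⟨φ, rfl⟩ := hJ.exists_lift f
      exact ⟨Ext.mk₀ φ, hmk φ⟩
  | succ n ih =>
    constructor
    · rw [injective_iff_map_eq_zero]
      intro x hx
      obtain ⟨P, p, _, hp⟩ := Ext.exists_epi_mk₀_comp_eq_zero x
      let S := ShortComplex.mk _ _ (kernel.condition p)
      have hS : S.ShortExact := { exact := ShortComplex.exact_kernel p }
      obtain ⟨y, rfl⟩ := Ext.contravariant_sequence_exact₃ hS J x hp (add_comm 1 n)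
      rw [extAdj_extClass_comp hS] at hx
      obtain ⟨z, hz⟩ := Ext.contravariant_sequence_exact₁ (hS.map_of_exact (forget α)) Y
        (extAdj S.X₁ ε n y) (add_comm 1 n) hx
      obtain ⟨z, rfl⟩ := (ih S.X₂).2 z
      have : (Ext.mk₀ S.f).comp z (zero_add n) = y :=
        (ih S.X₁).1 ((extAdj_mk₀_comp S.f ε z).trans hz)
      rw [← this]
      exact hS.extClass_comp_assoc _
    · intro y
      obtain ⟨P, p, _, hp⟩ := Ext.exists_epi_mk₀_comp_eq_zero y
      -- The effacing epimorphism `p` lives only in `D`; an equivariant epimorphism factoring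
      -- through it still kills `y`.
      obtain ⟨Q, q, r, _, hr⟩ := exists_epi_factor p
      let S := ShortComplex.mk _ _ (kernel.condition q)
      have hS : S.ShortExact := { exact := ShortComplex.exact_kernel q }
      have hq : (Ext.mk₀ q.hom).comp y (zero_add (n + 1)) = 0 := by
        rw [← hr, ← Ext.mk₀_comp_mk₀_assoc, hp, Ext.comp_zero]
      obtain ⟨z, hz⟩ := Ext.contravariant_sequence_exact₃ (hS.map_of_exact (forget α)) Y y hq
        (add_comm 1 n)
      obtain ⟨z, rfl⟩ := (ih S.X₁).2 z
      exact ⟨hS.extClass.comp z (add_comm 1 n), (extAdj_extClass_comp hS ε _ z).trans hz⟩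

end Ext

end EquivariantObject

/-! ### Dimension shifting and retracts for comparison maps -/

section ExactFunctor

variable {C : Type u₁} [Category.{v₁} C] [Abelian C] {D : Type u₂} [Category.{v₂} D] [Abelian D]
  (F : C ⥤ D) [F.Additive] [PreservesFiniteLimits F] [PreservesFiniteColimits F]
  [HasExt.{t} C] [HasExt.{t₁} D]

lemma bijective_mapExtAddHom_zero_iff (X Y : C) :
    Function.Bijective (F.mapExtAddHom X Y 0 : Ext.{t} _ _ 0 →+ Ext.{t₁} _ _ 0) ↔
      Function.Bijective (F.map : (X ⟶ Y) → _) := by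
  simp [Ext.mapExactFunctor₀]

/-- This is one half of the five lemma for the covariant long exact sequences of `S` and its image
under `F`; `surjective_mapExtAddHom_succ` is the other half. -/
lemma injective_mapExtAddHom_succ {S : ShortComplex C} (hS : S.ShortExact) (X : C) {n : ℕ}
    (h₂ : Function.Surjective (F.mapExtAddHom X S.X₂ n : Ext.{t} _ _ n →+ Ext.{t₁} _ _ n))
    (h₃ : Function.Injective (F.mapExtAddHom X S.X₃ n : Ext.{t} _ _ n →+ Ext.{t₁} _ _ n))
    (h₂' : Function.Injective
      (F.mapExtAddHom X S.X₂ (n + 1) : Ext.{t} _ _ _ →+ Ext.{t₁} _ _ _)) :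
    Function.Injective (F.mapExtAddHom X S.X₁ (n + 1) : Ext.{t} _ _ _ →+ Ext.{t₁} _ _ _) := by
  rw [injective_iff_map_eq_zero]
  simp only [Functor.mapExtAddHom_apply]
  intro x hx
  have h : x.comp (Ext.mk₀ S.f) (add_zero _) = 0 := by
    refine (injective_iff_map_eq_zero _).1 h₂' _ ?_
    rw [Functor.mapExtAddHom_apply, Ext.mapExactFunctor_comp, hx, Ext.zero_comp]
  obtain ⟨z, rfl⟩ := Ext.covariant_sequence_exact₁ X hS x h rfl
  rw [Ext.mapExactFunctor_comp, Ext.mapExactFunctor_extClass] at hx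
  obtain ⟨y, hy⟩ := Ext.covariant_sequence_exact₃ _ (hS.map_of_exact F) _ rfl hx
  obtain ⟨w, rfl⟩ := h₂ y
  have hw : w.comp (Ext.mk₀ S.g) (add_zero n) = z := h₃ (by
    rw [Functor.mapExtAddHom_apply, Ext.mapExactFunctor_comp, Ext.mapExactFunctor_mk₀]
    exact hy)
  rw [← hw, Ext.comp_assoc_of_second_deg_zero, hS.comp_extClass, Ext.comp_zero]

lemma surjective_mapExtAddHom_succ {S : ShortComplex C} (hS : S.ShortExact) (X : C) {n : ℕ}
    (h₃ : Function.Surjective (F.mapExtAddHom X S.X₃ n : Ext.{t} _ _ n →+ Ext.{t₁} _ _ n))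
    (h₂' : Function.Surjective
      (F.mapExtAddHom X S.X₂ (n + 1) : Ext.{t} _ _ _ →+ Ext.{t₁} _ _ _))
    (h₃' : Function.Injective
      (F.mapExtAddHom X S.X₃ (n + 1) : Ext.{t} _ _ _ →+ Ext.{t₁} _ _ _)) :
    Function.Surjective (F.mapExtAddHom X S.X₁ (n + 1) : Ext.{t} _ _ _ →+ Ext.{t₁} _ _ _) := by
  intro y
  obtain ⟨w, hw⟩ := h₂' (y.comp (Ext.mk₀ (F.map S.f)) (add_zero _))
  rw [Functor.mapExtAddHom_apply] at hw
  have h : w.comp (Ext.mk₀ S.g) (add_zero _) = 0 := by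
    refine (injective_iff_map_eq_zero _).1 h₃' _ ?_
    rw [Functor.mapExtAddHom_apply, Ext.mapExactFunctor_comp, Ext.mapExactFunctor_mk₀, hw,
      Ext.comp_assoc_of_third_deg_zero, Ext.mk₀_comp_mk₀, ← Functor.map_comp, S.zero,
      Functor.map_zero, Ext.mk₀_zero, Ext.comp_zero]
  obtain ⟨x, rfl⟩ := Ext.covariant_sequence_exact₂ X hS w h
  rw [Ext.mapExactFunctor_comp, Ext.mapExactFunctor_mk₀] at hw
  obtain ⟨c, hc⟩ := Ext.covariant_sequence_exact₁ _ (hS.map_of_exact F)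
    (y + -x.mapExactFunctor F)
    ((Ext.add_comp _ _ _ _).trans ((congrArg _ (Ext.neg_comp _ _ _)).trans
      (add_neg_eq_zero.2 hw.symm))) rfl
  obtain ⟨z, rfl⟩ := h₃ c
  refine ⟨z.comp hS.extClass rfl + x, ?_⟩
  rw [map_add, Functor.mapExtAddHom_apply, Functor.mapExtAddHom_apply, Ext.mapExactFunctor_comp,
    Ext.mapExactFunctor_extClass]
  exact eq_add_neg_iff_add_eq.1 hc

lemma bijective_mapExtAddHom_of_isSplitEpi {V X Y : C} (p : V ⟶ X) [IsSplitEpi p] {n : ℕ}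
    (h : Function.Bijective (F.mapExtAddHom V Y n : Ext.{t} _ _ n →+ Ext.{t₁} _ _ n)) :
    Function.Bijective (F.mapExtAddHom X Y n : Ext.{t} _ _ n →+ Ext.{t₁} _ _ n) := by
  have hp (x : Ext.{t} X Y n) :
      (Ext.mk₀ (section_ p)).comp ((Ext.mk₀ p).comp x (zero_add n)) (zero_add n) = x := by
    rw [Ext.mk₀_comp_mk₀_assoc, IsSplitEpi.id, Ext.mk₀_id_comp]
  have hFp (y : Ext.{t₁} (F.obj X) (F.obj Y) n) : (Ext.mk₀ (F.map (section_ p))).comp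
      ((Ext.mk₀ (F.map p)).comp y (zero_add n)) (zero_add n) = y := by
    rw [Ext.mk₀_comp_mk₀_assoc, ← Functor.map_comp, IsSplitEpi.id, CategoryTheory.Functor.map_id,
      Ext.mk₀_id_comp]
  constructor
  · intro x x' hxx'
    simp only [Functor.mapExtAddHom_apply] at hxx'
    rw [← hp x, ← hp x']
    congr 1
    apply h.1
    simp only [Functor.mapExtAddHom_apply, Ext.mapExactFunctor_comp, hxx']
  · intro y
    obtain ⟨z, hz⟩ := h.2 ((Ext.mk₀ (F.map p)).comp y (zero_add n))
    refine ⟨(Ext.mk₀ (section_ p)).comp z (zero_add n), ?_⟩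
    rw [Functor.mapExtAddHom_apply] at hz ⊢
    rw [Ext.mapExactFunctor_comp, Ext.mapExactFunctor_mk₀, hz, hFp]

end ExactFunctor

/-! ### Coinduced objects and full faithfulness under G-functors -/

section Functors

variable {G : Type w} [Group G] {A : Type u₁} [Category.{v₁} A] {B : Type u₂} [Category.{v₂} B]
  {α : RightAction G A} {β : RightAction G B} {F : A ⥤ B} (s : GFunctorStructure α β F)

/-- `F` preserves the finite product over `G`, and `σ` rewrites its factors $F\rho_h Y$ as $\rho_h F
Y$. -/
lemma EquivariantObject.IsCoinduced.map [Finite G] [PreservesFiniteProducts F]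
    {J : EquivariantObject α} {Y : A} {ε : J.obj ⟶ Y} (hJ : IsCoinduced J ε) :
    IsCoinduced ((equivariantFunctor s).obj J) (F.map ε) := by
  have key := (IsProductFan.map hJ F).comp_iso fun h => (s.σ h).app Y
  have e : (fun h => (((equivariantFunctor s).obj J).χ h).hom ≫ (β.ρ h).map (F.map ε)) =
      fun h => F.map ((J.χ h).hom ≫ (α.ρ h).map ε) ≫ ((s.σ h).app Y).hom := by
    funext h
    have nat := (s.σ h).hom.naturality ε
    simp only [Functor.comp_map] at nat
    simp [equivariantFunctor, nat]
  unfold IsCoinduced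
  rw [e]
  exact key

lemma bijective_map_equivariantFunctor
    (hF : ∀ X Y : A, Function.Bijective (F.map : (X ⟶ Y) → _)) (X Y : EquivariantObject α) :
    Function.Bijective ((equivariantFunctor s).map : (X ⟶ Y) → _) := by
  refine ⟨fun f f' h => EquivariantObject.hom_ext ((hF _ _).1 (congrArg Hom.hom h)), fun f => ?_⟩
  obtain ⟨g, hg⟩ := (hF X.obj Y.obj).2 f.hom
  refine ⟨⟨g, fun h => (hF _ _).1 ?_⟩, EquivariantObject.hom_ext hg⟩
  have nat := (s.σ h).hom.naturality g
  have comm := f.comm h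
  simp only [Functor.comp_map] at nat
  rw [← hg] at comm
  simp only [equivariantFunctor, Iso.trans_hom, Functor.mapIso_hom, Iso.app_hom,
    Category.assoc] at comm
  rw [← nat, ← Category.assoc, ← Category.assoc, cancel_mono] at comm
  rw [Functor.map_comp, Functor.map_comp, comm]

end Functors

/-! ### Comparing the Ext maps of F and its equivariant functor -/

section ExactFunctors

variable {G : Type w} [Group G] {A : Type u₁} [Category.{v₁} A] [Abelian A]
  {B : Type u₂} [Category.{v₂} B] [Abelian B] {α : RightAction G A} {β : RightAction G B}
  {F : A ⥤ B} (s : GFunctorStructure α β F)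

instance [F.Additive] : (equivariantFunctor s).Additive where
  map_add := EquivariantObject.hom_ext F.map_add

instance [PreservesFiniteLimits F] : PreservesFiniteLimits (equivariantFunctor s) :=
  have : PreservesFiniteLimits (equivariantFunctor s ⋙ forget β) :=
    inferInstanceAs (PreservesFiniteLimits (forget α ⋙ F))
  preservesFiniteLimits_of_reflects_of_preserves _ (forget β)

instance [PreservesFiniteColimits F] : PreservesFiniteColimits (equivariantFunctor s) :=
  have : PreservesFiniteColimits (equivariantFunctor s ⋙ forget β) :=
    inferInstanceAs (PreservesFiniteColimits (forget α ⋙ F))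
  preservesFiniteColimits_of_reflects_of_preserves _ (forget β)

variable [F.Additive] [PreservesFiniteLimits F] [PreservesFiniteColimits F]
  [HasExt.{t} A] [HasExt.{t₁} (EquivariantObject α)]
  [HasExt.{t₂} B] [HasExt.{t₃} (EquivariantObject β)]

/-- Forgetting after $F^G$ is, by definition, `F` after forgetting; functoriality of Ext in exact
functors does the rest. -/
lemma extAdj_mapExactFunctor {W J : EquivariantObject α} {Y : A} (ε : J.obj ⟶ Y) {n : ℕ}
    (x : Ext.{t₁} W J n) :
    (extAdj ((equivariantFunctor s).obj W) (J := (equivariantFunctor s).obj J) (F.map ε) n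
      (x.mapExactFunctor (equivariantFunctor s) : Ext.{t₃} _ _ n) : Ext.{t₂} _ _ n) =
      (extAdj W ε n x : Ext.{t} _ _ n).mapExactFunctor F := by
  refine Eq.trans ?_ (((Ext.mapExactFunctor_comp F _ _ _).trans
    (congrArg (Abelian.Ext.comp _ · (add_zero n)) (Ext.mapExactFunctor_mk₀ F ε))).symm)
  exact congrArg (Abelian.Ext.comp · (Ext.mk₀ (F.map ε)) (add_zero n))
    ((Ext.mapExactFunctor_mapExactFunctor (equivariantFunctor s) (forget β) x).trans
      (Ext.mapExactFunctor_mapExactFunctor (forget α) F x).symm)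

/-- The comparison map of a `G`-functor on extensions by a coinduced object is bijective if and only
if the comparison map of the underlying functor is. -/
lemma bijective_mapExtAddHom_iff_of_isCoinduced [Finite G] {W J : EquivariantObject α} {Y : A}
    {ε : J.obj ⟶ Y} (hJ : IsCoinduced J ε) (n : ℕ) :
    Function.Bijective ((equivariantFunctor s).mapExtAddHom W J n :
      Ext.{t₁} _ _ n →+ Ext.{t₃} _ _ n) ↔
    Function.Bijective (F.mapExtAddHom W.obj Y n : Ext.{t} _ _ n →+ Ext.{t₂} _ _ n) := by
  have h₁ : Function.Bijective (extAdj W ε n : Ext.{t₁} _ _ n → Ext.{t} _ _ n) :=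
    hJ.bijective_extAdj W n
  have h₂ : Function.Bijective (extAdj ((equivariantFunctor s).obj W) (F.map ε) n :
      Ext.{t₃} _ ((equivariantFunctor s).obj J) n → Ext.{t₂} _ _ n) :=
    (hJ.map s).bijective_extAdj _ n
  rw [← Function.Bijective.of_comp_iff' h₂, ← Function.Bijective.of_comp_iff _ h₁]
  exact Eq.to_iff (congrArg Function.Bijective (funext (extAdj_mapExactFunctor s ε)))

theorem bijective_mapExtAddHom_equivariantFunctor [Finite G] {k : ℕ}
    (hF : ∀ (X Y : A) (n : ℕ), n ≤ k →
      Function.Bijective (F.mapExtAddHom X Y n : Ext.{t} _ _ n →+ Ext.{t₂} _ _ n))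
    (X Y : EquivariantObject α) (n : ℕ) (hn : n ≤ k) :
    Function.Bijective ((equivariantFunctor s).mapExtAddHom X Y n :
      Ext.{t₁} _ _ n →+ Ext.{t₃} _ _ n) := by
  induction n generalizing Y with
  | zero =>
    rw [bijective_mapExtAddHom_zero_iff]
    exact bijective_map_equivariantFunctor s
      (fun X Y => (bijective_mapExtAddHom_zero_iff F X Y).1 (hF X Y 0 (Nat.zero_le k))) X Y
  | succ n ih =>
    have ih' := fun Y => ih Y (by lia)
    have hJ' (J : EquivariantObject α) {Z : A} {ε : J.obj ⟶ Z} (hJ : IsCoinduced J ε) :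
      Function.Bijective ((equivariantFunctor s).mapExtAddHom X J (n + 1) :
        Ext.{t₁} _ _ (n + 1) →+ Ext.{t₃} _ _ (n + 1)) := by
      have h := hF X.obj Z (n + 1) hn
      exact (bijective_mapExtAddHom_iff_of_isCoinduced s hJ (n + 1)).2 h
    -- Injectivity is needed for all `Y` first: surjectivity at `Y` uses injectivity in the same
    -- degree at the cokernel of `η`.
    have inj (Y : EquivariantObject α) :
        Function.Injective ((equivariantFunctor s).mapExtAddHom X Y (n + 1) :
          Ext.{t₁} _ _ (n + 1) →+ Ext.{t₃} _ _ (n + 1)) := by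
      obtain ⟨J, ε, η, hJ, _⟩ := exists_mono_isCoinduced Y
      exact injective_mapExtAddHom_succ (equivariantFunctor s)
        (S := ShortComplex.mk _ _ (cokernel.condition η))
        { exact := ShortComplex.exact_cokernel η } X (ih' _).2 (ih' _).1 (hJ' J hJ).1
    obtain ⟨J, ε, η, hJ, _⟩ := exists_mono_isCoinduced Y
    exact ⟨inj Y, surjective_mapExtAddHom_succ (equivariantFunctor s)
      (S := ShortComplex.mk _ _ (cokernel.condition η))
      { exact := ShortComplex.exact_cokernel η } X (ih' _).2 (hJ' J hJ).2 (inj _)⟩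

/-- Coinducing both arguments gives bijectivity at `(W.obj, Y)`, and `X` is a retract of `W.obj`.
Each degree is treated on its own. -/
lemma bijective_mapExtAddHom_of_equivariantFunctor [Finite G] {n : ℕ}
    (h : ∀ X Y : EquivariantObject α, Function.Bijective
      ((equivariantFunctor s).mapExtAddHom X Y n : Ext.{t₁} _ _ n →+ Ext.{t₃} _ _ n)) (X Y : A) :
    Function.Bijective (F.mapExtAddHom X Y n : Ext.{t} _ _ n →+ Ext.{t₂} _ _ n) := by
  obtain ⟨J, ε, hJ⟩ := exists_isCoinduced (α := α) Y
  obtain ⟨W, δ, hW⟩ := exists_isCoinduced (α := α) X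
  have hδ := hW.isSplitEpi
  have hbij := h W J
  exact bijective_mapExtAddHom_of_isSplitEpi F δ
    ((bijective_mapExtAddHom_iff_of_isCoinduced s hJ n).1 hbij)

end ExactFunctors

end Equivariant

namespace Equivariant

/-! ### Restricting an action along a fully faithful functor -/

section InducedAction

variable {G : Type w} [Group G] {A : Type u₁} [Category.{v₁} A] {B : Type u₂} [Category.{v₂} B]

namespace RightAction

/-- The isomorphism $\rho_1\rho_1 Y \cong \rho_1 Y$ lifts through the fully faithful $\rho_1$. -/
lemma nonempty_iso_ρ_one (β : RightAction G B) (Y : B) : Nonempty ((β.ρ 1).obj Y ≅ Y) :=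
  ⟨(β.ρ 1).preimageIso ((β.θ 1 1).app Y ≪≫ eqToIso (by simp))⟩

lemma exists_essImage_iso {β : RightAction G B} {i : A ⥤ B}
    (hi : ∀ (g : G) (X : A), i.essImage ((β.ρ g).obj (i.obj X))) (g : G) (Y : A) :
    ∃ X : A, Nonempty ((β.ρ g).obj (i.obj X) ≅ i.obj Y) := by
  obtain ⟨e⟩ := nonempty_iso_ρ_one β (i.obj Y)
  let c := (hi g⁻¹ Y).getIso
  refine ⟨(hi g⁻¹ Y).witness, ⟨(β.ρ g).mapIso c ≪≫ (β.θ g g⁻¹).app (i.obj Y) ≪≫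
    eqToIso (by rw [inv_mul_cancel]) ≪≫ e⟩⟩

/-- The functors of the action induced along a fully faithful functor with stable image. -/
noncomputable def inducedρ {β : RightAction G B} {i : A ⥤ B} [i.Full] [i.Faithful]
    (hi : ∀ (g : G) (X : A), i.essImage ((β.ρ g).obj (i.obj X))) (g : G) : A ⥤ A where
  obj X := (hi g X).witness
  map {X Y} f := i.preimage
    ((hi g X).getIso.hom ≫ (β.ρ g).map (i.map f) ≫ (hi g Y).getIso.inv)
  map_id X := i.map_injective (by simp)
  map_comp f f' := i.map_injective (by simp)

/-- The inclusion intertwines the induced functors with the given ones. -/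
noncomputable def inducedσ {β : RightAction G B} {i : A ⥤ B} [i.Full] [i.Faithful]
    (hi : ∀ (g : G) (X : A), i.essImage ((β.ρ g).obj (i.obj X))) (g : G) :
    inducedρ hi g ⋙ i ≅ i ⋙ β.ρ g :=
  NatIso.ofComponents (fun X => (hi g X).getIso) (fun f => by simp [inducedρ])

variable {β : RightAction G B} {i : A ⥤ B} [i.Full] [i.Faithful]
  (hi : ∀ (g : G) (X : A), i.essImage ((β.ρ g).obj (i.obj X)))

lemma inducedσ_naturality (g : G) {X Y : A} (f : X ⟶ Y) :
    i.map ((inducedρ hi g).map f) ≫ (inducedσ hi g).hom.app Y =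
      (inducedσ hi g).hom.app X ≫ (β.ρ g).map (i.map f) :=
  (inducedσ hi g).hom.naturality f

lemma inducedρ_isEquivalence (g : G) : (inducedρ hi g).IsEquivalence where
  faithful := ⟨fun {X Y f f'} h => by
    apply i.map_injective
    apply (β.ρ g).map_injective
    rw [← cancel_epi ((inducedσ hi g).hom.app X), ← inducedσ_naturality, h, inducedσ_naturality]⟩
  full := ⟨fun {X Y} f => by
    let k := (inducedσ hi g).inv.app X ≫ i.map f ≫ (inducedσ hi g).hom.app Y
    refine ⟨i.preimage ((β.ρ g).preimage k), i.map_injective ?_⟩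
    rw [← cancel_mono ((inducedσ hi g).hom.app Y), inducedσ_naturality]
    simp [k]⟩
  essSurj := ⟨fun Y => by
    obtain ⟨X, ⟨e⟩⟩ := exists_essImage_iso hi g Y
    exact ⟨X, ⟨i.preimageIso ((inducedσ hi g).app X ≪≫ e)⟩⟩⟩

/-- The composition isomorphisms of the induced action, after applying the inclusion. -/
noncomputable def inducedθIso (g h : G) (X : A) :
    i.obj ((inducedρ hi g).obj ((inducedρ hi h).obj X)) ≅ i.obj ((inducedρ hi (h * g)).obj X) :=
  (inducedσ hi g).app _ ≪≫ (β.ρ g).mapIso ((inducedσ hi h).app X) ≪≫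
    (β.θ g h).app (i.obj X) ≪≫ ((inducedσ hi (h * g)).app X).symm

lemma inducedθIso_hom_comp (g h : G) (X : A) :
    (inducedθIso hi g h X).hom ≫ (inducedσ hi (h * g)).hom.app X =
      (inducedσ hi g).hom.app ((inducedρ hi h).obj X) ≫
        (β.ρ g).map ((inducedσ hi h).hom.app X) ≫ (β.θ g h).hom.app (i.obj X) := by
  simp [inducedθIso]

/-- The composition isomorphisms of the induced action. -/
noncomputable def inducedθ (g h : G) :
    inducedρ hi h ⋙ inducedρ hi g ≅ inducedρ hi (h * g) :=
  NatIso.ofComponents (fun X => i.preimageIso (inducedθIso hi g h X)) (fun {X Y} f => by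
    have n1 := (β.θ g h).hom.naturality (i.map f)
    simp only [Functor.comp_map] at n1
    apply i.map_injective
    rw [← cancel_mono ((inducedσ hi (h * g)).hom.app Y)]
    simp only [Functor.map_comp, Functor.preimageIso_hom, Functor.map_preimage, Category.assoc,
      Functor.comp_map]
    rw [inducedσ_naturality, inducedθIso_hom_comp, reassoc_of% (inducedσ_naturality hi g),
      reassoc_of% (inducedθIso_hom_comp hi g h X), ← n1, ← Functor.map_comp_assoc,
      inducedσ_naturality, Functor.map_comp_assoc])

lemma map_inducedθ_comp (g h : G) (X : A) :
    i.map ((inducedθ hi g h).hom.app X) ≫ (inducedσ hi (h * g)).hom.app X =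
      (inducedσ hi g).hom.app ((inducedρ hi h).obj X) ≫
        (β.ρ g).map ((inducedσ hi h).hom.app X) ≫ (β.θ g h).hom.app (i.obj X) := by
  rw [← inducedθIso_hom_comp]
  simp [inducedθ]

lemma map_eqToHom_comp_inducedσ {a b : G} (h : a = b) (X : A) :
    i.map (eqToHom (by rw [h]) : (inducedρ hi a).obj X ⟶ (inducedρ hi b).obj X) ≫
      (inducedσ hi b).hom.app X = (inducedσ hi a).hom.app X ≫ eqToHom (by rw [h]) := by
  subst h
  simp

/-- The action induced along a fully faithful functor with stable essential image. -/
noncomputable def induced : RightAction G A where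
  ρ := inducedρ hi
  isEquivalence := inducedρ_isEquivalence hi
  θ := inducedθ hi
  cocycle g h k X := by
    -- After applying the faithful `i` and cancelling the intertwiner, the identity reduces to the
    -- cocycle condition of `β`.
    apply i.map_injective
    rw [← cancel_mono ((inducedσ hi (k * (h * g))).hom.app X)]
    simp only [Functor.map_comp, Category.assoc]
    rw [map_inducedθ_comp, map_eqToHom_comp_inducedσ hi (mul_assoc k h g),
      reassoc_of% (map_inducedθ_comp hi g (k * h) X), reassoc_of% (inducedσ_naturality hi g),
      reassoc_of% (map_inducedθ_comp hi g h)]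
    have n1 := (β.θ g h).hom.naturality ((inducedσ hi k).hom.app X)
    simp only [Functor.comp_map] at n1
    rw [← reassoc_of% n1, ← β.cocycle, ← Functor.map_comp_assoc, map_inducedθ_comp]
    simp only [Functor.map_comp, Category.assoc]
    rfl

/-- The `G`-functor structure of the inclusion for the induced action. -/
noncomputable def inducedStructure : GFunctorStructure (induced hi) β i where
  σ := inducedσ hi
  assoc g h X := map_inducedθ_comp hi g h X

end RightAction

end InducedAction

/-! ### Stability of the kernel in a recollement -/

namespace AbelianRecollement

variable {G : Type w} [Group G] {A : Type u₁} [Category.{v₁} A] [Abelian A]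
  {B : Type u₂} [Category.{v₂} B] [Abelian B] {C : Type u₃} [Category.{v₃} C] [Abelian C]
  {R : AbelianRecollement A B C} {β : RightAction G B}

/-- If `e` is a $G$-functor, then $e\rho_g i X \cong \rho_g e i X = 0$, and the image of `i` is the
kernel of `e`. -/
lemma LiftsToEquivariant.essImage (h : R.LiftsToEquivariant β) (g : G) (X : A) :
    R.i.essImage ((β.ρ g).obj (R.i.obj X)) := by
  rcases h with ⟨γ, ⟨s⟩⟩ | h
  · rw [R.image_eq_kernel]
    have h0 : IsZero (R.e.obj (R.i.obj X)) := (R.image_eq_kernel _).1 (R.i.obj_mem_essImage X)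
    exact ((γ.ρ g).map_isZero h0).of_iso ((s.σ g).app (R.i.obj X))
  · exact h g X

end AbelianRecollement

end Equivariant

theorem mainTheorem6 (G : Type w) [Group G] [Finite G]
    (A : Type u₁) [Category.{v₁} A] [Abelian A]
    (B : Type u₂) [Category.{v₂} B] [Abelian B]
    (β : Equivariant.RightAction G B) (k : ℕ) :
    -- for every exact `G`-functor, being a `k`-homological embedding passes to `F^G`
    (∀ (α : Equivariant.RightAction G A) (F : A ⥤ B)
        (s : Equivariant.GFunctorStructure α β F),
        Equivariant.IsHomologicalEmbedding F k →
          Equivariant.IsHomologicalEmbedding (Equivariant.equivariantFunctor s) k) ∧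
    -- for recollements that lift to a `G`-equivariant recollement, `A` has an induced action
    -- making `i` a `G`-functor, and `i` is a `k`-homological embedding if and only if `i^G` is
    (∀ (C : Type u₃) [Category.{v₃} C] [Abelian C]
        (R : Equivariant.AbelianRecollement A B C),
        (EnoughProjectives B ∨ EnoughInjectives B) →
        Equivariant.IsInvertibleIn (Nat.card G) B →
        R.LiftsToEquivariant β →
        (∃ α : Equivariant.RightAction G A,
          Nonempty (Equivariant.GFunctorStructure α β R.i)) ∧
        ∀ (α : Equivariant.RightAction G A)
          (s : Equivariant.GFunctorStructure α β R.i),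
          Equivariant.IsHomologicalEmbedding R.i k ↔
            Equivariant.IsHomologicalEmbedding (Equivariant.equivariantFunctor s) k) := by
  have lift (α : Equivariant.RightAction G A) (F : A ⥤ B) (s : Equivariant.GFunctorStructure α β F)
      (hF : Equivariant.IsHomologicalEmbedding F k) :
      Equivariant.IsHomologicalEmbedding (Equivariant.equivariantFunctor s) k := by
    obtain ⟨_, _, _, hF⟩ := hF
    exact ⟨inferInstance, inferInstance, inferInstance,
      letI := HasExt.standard A
      letI := HasExt.standard B
      letI := HasExt.standard (Equivariant.EquivariantObject α)
      letI := HasExt.standard (Equivariant.EquivariantObject β)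
      Equivariant.bijective_mapExtAddHom_equivariantFunctor s hF⟩
  refine ⟨lift, fun C _ _ R _ _ hR => ⟨?_, fun α s => ⟨lift α R.i s, fun h => ?_⟩⟩⟩
  · have := R.i_full
    have := R.i_faithful
    exact ⟨.induced hR.essImage, ⟨Equivariant.RightAction.inducedStructure hR.essImage⟩⟩
  · obtain ⟨_, _, _, h⟩ := h
    -- Exactness of `i` comes from its two adjoints; only the Ext bijections are taken from the
    -- equivariant side.
    have : PreservesFiniteLimits R.i := ⟨fun J _ _ => R.adjQI.rightAdjoint_preservesLimits.1⟩
    have : PreservesFiniteColimits R.i := ⟨fun J _ _ => R.adjIP.leftAdjoint_preservesColimits.1⟩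
    have : R.i.Additive := R.i.additive_of_preserves_binary_products
    exact ⟨inferInstance, inferInstance, inferInstance,
      letI := HasExt.standard A
      letI := HasExt.standard B
      letI := HasExt.standard (Equivariant.EquivariantObject α)
      letI := HasExt.standard (Equivariant.EquivariantObject β)
      fun X Y n hn => Equivariant.bijective_mapExtAddHom_of_equivariantFunctor s
        (fun W J => h W J n hn) X Y⟩
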